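/- Let $M$ be a smooth manifold with a contact metric structure $(\eta,\xi,\Phi,g)$. That is, $\eta$ is a contact form on $M$: a smooth $1$-form that vanishes nowhere and for which $d\eta$ is nondegenerate on ${\mathcal D}=\ker\eta$, where $d\eta(X,Y)=X\eta(Y)-Y\eta(X)-\eta([X,Y])$. The smooth vector field $\xi$ is its Reeb vector field, so $\eta(\xi)=1$ and $d\eta(\xi,\cdot)=0$. The smooth section $\Phi$ of $\operatorname{End}TM$ and the Riemannian metric $g$ satisfy $$\Phi\xi=0,\qquad \Phi^2=-\mathrm{Id}+\eta\otimes\xi,$$ $$g(X,Y)=d\eta(X,\Phi Y)+\eta(X)\eta(Y),\qquad g(\Phi X,\Phi Y)=g(X,Y)-\eta(X)\eta(Y)$$ for all vector fields $X,Y$. Let $J=\Phi|_{\mathcal D}$, let $\nabla$ be the Levi-Civita connection of $g$, and let $V^h=V-\eta(V)\xi$ be the projection onto ${\mathcal D}$. The induced connection $\nabla^{\mathcal D}$ on ${\mathcal D}$ is determined, for smooth sections $Y$ of ${\mathcal D}$, by $$\nabla^{\mathcal D}_XY=(\nabla_XY)^h \ \text{ if } X \text{ is a section of } {\mathcal D},\qquad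 \nabla^{\mathcal D}_\xi Y=[\xi,Y]^h,$$ and linearity over functions in $X$. The almost CR structure $J$ is called integrable if for all smooth sections $X,Y$ of ${\mathcal D}$ the field $[X,JY]+[JX,Y]$ is a section of ${\mathcal D}$ and $$J\big([X,JY]+[JX,Y]\big)=[JX,JY]-[X,Y].$$ Then $\nabla^{\mathcal D}J=0$, that is, $\nabla^{\mathcal D}_X(JY)=J(\nabla^{\mathcal D}_XY)$ for all vector fields $X$ on $M$ and all smooth sections $Y$ of ${\mathcal D}$, if and only if $J$ is integrable and ${\mathcal L}_\xi\Phi=0$, that is, $[\xi,\Phi Y]=\Phi[\xi,Y]$ for all smooth vector fields $Y$ on $M$. -/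

import Mathlib

open scoped Manifold ContDiff Bundle Topology

noncomputable section

namespace ContactGeometry

open Bundle VectorField

variable {E : Type*} [NormedAddCommGroup E] [NormedSpace ℝ E] [FiniteDimensional ℝ E]
  {H : Type*} [TopologicalSpace H] {I : ModelWithCorners ℝ E H}
  {M : Type*} [TopologicalSpace M] [ChartedSpace H M] [IsManifold I ∞ M]

set_option linter.unusedSectionVars false

/-! ### One-forms and the exterior derivative -/

variable (I M) in
/-- A smooth 1-form on `M`. -/
structure OneForm where
  toFun : ∀ x : M, TangentSpace I x →L[ℝ] ℝ
  smooth : ContMDiff I (I.prod 𝓘(ℝ, E →L[ℝ] ℝ)) ∞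
    (fun x ↦ TotalSpace.mk' (E →L[ℝ] ℝ) x (toFun x))

namespace OneForm

variable (α : OneForm I M)

theorem mdiffAt_apply {X : ∀ x : M, TangentSpace I x} {x : M} (hX : MDiffAt (T% X) x) :
    MDiffAt (fun y ↦ α.toFun y (X y)) x := by
  have h1 : MDifferentiableAt I (I.prod 𝓘(ℝ, E →L[ℝ] ℝ))
      (fun x ↦ TotalSpace.mk' (E →L[ℝ] ℝ) x (α.toFun x)) x :=
    α.smooth.mdifferentiableAt (by simp)
  have h2 : MDifferentiableAt I (I.prod 𝓘(ℝ))
      (fun m ↦ TotalSpace.mk' ℝ (E := Bundle.Trivial M ℝ) m (α.toFun m (X m))) x :=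
    MDifferentiableAt.clm_bundle_apply (F₁ := E) (F₂ := ℝ) h1 hX
  simp only [mdifferentiableAt_totalSpace] at h2
  exact h2.2

/-- The expression `X (α Y) - Y (α X) - α [X, Y]` in two vector fields `X`, `Y`. -/
def dAux (X Y : ∀ x : M, TangentSpace I x) (x : M) : ℝ :=
  d% (fun y ↦ α.toFun y (Y y)) x (X x) - d% (fun y ↦ α.toFun y (X y)) x (Y x)
    - α.toFun x (mlieBracket I X Y x)

theorem dAux_swap (X Y : ∀ x : M, TangentSpace I x) (x : M) :
    α.dAux X Y x = - α.dAux Y X x := by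
  simp only [dAux, mlieBracket_swap_apply (V := X), map_neg]
  ring

theorem dAux_tensorial_left (Y : ∀ x : M, TangentSpace I x) {x : M} (_hY : MDiffAt (T% Y) x) :
    TensorialAt I E (fun X ↦ α.dAux X Y x) x where
  smul {f X} hf hX := by
    have h : d% (fun y ↦ α.toFun y ((f • X) y)) x (Y x)
        = f x * d% (fun y ↦ α.toFun y (X y)) x (Y x) + α.toFun x (X x) * d% f x (Y x) := by
      have := mvfderiv_mul hf (α.mdiffAt_apply hX)
      have h2 : (fun y ↦ α.toFun y ((f • X) y)) = f * (fun y ↦ α.toFun y (X y)) := by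
        ext y; simp
      rw [h2, this]
      simp
    simp only [dAux, h, mlieBracket_smul_left hf hX]
    simp
    ring
  add {X X'} hX hX' := by
    have h : d% (fun y ↦ α.toFun y ((X + X') y)) x
        = d% (fun y ↦ α.toFun y (X y)) x + d% (fun y ↦ α.toFun y (X' y)) x := by
      have := mvfderiv_add (α.mdiffAt_apply hX) (α.mdiffAt_apply hX')
      have h2 : (fun y ↦ α.toFun y ((X + X') y))
        = (fun y ↦ α.toFun y (X y)) + (fun y ↦ α.toFun y (X' y)) := by ext y; simp
      rw [h2, this]
    simp only [dAux, h, mlieBracket_add_left hX hX']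
    simp
    ring

theorem dAux_tensorial_right (X : ∀ x : M, TangentSpace I x) {x : M} (hX : MDiffAt (T% X) x) :
    TensorialAt I E (fun Y ↦ α.dAux X Y x) x where
  smul {f Y} hf hY := by
    have := (α.dAux_tensorial_left X hX).smul hf hY
    simp only [α.dAux_swap X]
    rw [this]; simp
  add {Y Y'} hY hY' := by
    have := (α.dAux_tensorial_left X hX).add hY hY'
    simp only [α.dAux_swap X]
    rw [this]; ring

/-- The exterior derivative of a 1-form, as a bilinear form on each tangent space, normalised by
`dα(X, Y) = X (α Y) - Y (α X) - α [X, Y]`. -/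
def d (x : M) : TangentSpace I x →L[ℝ] TangentSpace I x →L[ℝ] ℝ :=
  TensorialAt.mkHom₂ (fun X Y ↦ α.dAux X Y x) x
    (fun Y hY ↦ α.dAux_tensorial_left Y hY) (fun X hX ↦ α.dAux_tensorial_right X hX)

theorem d_apply {X Y : ∀ x : M, TangentSpace I x} {x : M}
    (hX : MDiffAt (T% X) x) (hY : MDiffAt (T% Y) x) :
    α.d x (X x) (Y x) =
      d% (fun y ↦ α.toFun y (Y y)) x (X x) - d% (fun y ↦ α.toFun y (X y)) x (Y x)
        - α.toFun x (mlieBracket I X Y x) :=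
  TensorialAt.mkHom₂_apply _ _ hX hY

/-- A contact form: `α` vanishes nowhere and `dα` is nondegenerate on the hyperplane field `ker α`,
that is, `(ker α, dα)` is a symplectic vector bundle. -/
def IsContact : Prop :=
  ∀ x : M, α.toFun x ≠ 0 ∧
    ∀ v, α.toFun x v = 0 → (∀ w, α.toFun x w = 0 → α.d x v w = 0) → v = 0

end OneForm

/-! ### The Levi-Civita connection -/

variable (I M) in
/-- A smooth Riemannian metric on `M`. -/
abbrev Metric := ContMDiffRiemannianMetric I ∞ E (fun x : M ↦ TangentSpace I x)

namespace Metric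

variable (g : Metric I M)

theorem mdiffAt_inner {X Y : ∀ x : M, TangentSpace I x} {x : M} (hX : MDiffAt (T% X) x)
    (hY : MDiffAt (T% Y) x) : MDiffAt (fun y ↦ g.inner y (X y) (Y y)) x := by
  have h1 : MDifferentiableAt I (I.prod 𝓘(ℝ, E →L[ℝ] E →L[ℝ] ℝ))
      (fun x ↦ TotalSpace.mk' (E →L[ℝ] E →L[ℝ] ℝ) x (g.inner x)) x :=
    g.contMDiff.mdifferentiableAt (by simp)
  have h2 : MDifferentiableAt I (I.prod 𝓘(ℝ))
      (fun m ↦ TotalSpace.mk' ℝ (E := Bundle.Trivial M ℝ) m (g.inner m (X m) (Y m))) x :=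
    MDifferentiableAt.clm_bundle_apply₂ (F₁ := E) (F₂ := E) h1 hX hY
  simp only [mdifferentiableAt_totalSpace] at h2
  exact h2.2

theorem d_inner_add {X X' Y : ∀ x : M, TangentSpace I x} {x : M} (hX : MDiffAt (T% X) x)
    (hX' : MDiffAt (T% X') x) (hY : MDiffAt (T% Y) x) :
    d% (fun y ↦ g.inner y ((X + X') y) (Y y)) x
      = d% (fun y ↦ g.inner y (X y) (Y y)) x + d% (fun y ↦ g.inner y (X' y) (Y y)) x := by
  have h2 : (fun y ↦ g.inner y ((X + X') y) (Y y))
    = (fun y ↦ g.inner y (X y) (Y y)) + (fun y ↦ g.inner y (X' y) (Y y)) := by ext y; simp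
  rw [h2, mvfderiv_add (g.mdiffAt_inner hX hY) (g.mdiffAt_inner hX' hY)]

theorem d_inner_smul {f : M → ℝ} {X Y : ∀ x : M, TangentSpace I x} {x : M} (hf : MDiffAt f x)
    (hX : MDiffAt (T% X) x) (hY : MDiffAt (T% Y) x) (v : TangentSpace I x) :
    d% (fun y ↦ g.inner y ((f • X) y) (Y y)) x v
      = f x * d% (fun y ↦ g.inner y (X y) (Y y)) x v + g.inner x (X x) (Y x) * d% f x v := by
  have h2 : (fun y ↦ g.inner y ((f • X) y) (Y y)) = f * (fun y ↦ g.inner y (X y) (Y y)) := by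
    ext y; simp
  rw [h2, mvfderiv_mul hf (g.mdiffAt_inner hX hY)]
  simp

theorem d_inner_comm (X Y : ∀ x : M, TangentSpace I x) (x : M) :
    d% (fun y ↦ g.inner y (X y) (Y y)) x = d% (fun y ↦ g.inner y (Y y) (X y)) x := by
  simp only [g.symm _ (X _)]

/-- The right-hand side of the Koszul formula for `2 g(∇_X Y, Z)`. -/
def koszul (X Y Z : ∀ x : M, TangentSpace I x) (x : M) : ℝ :=
  d% (fun y ↦ g.inner y (Y y) (Z y)) x (X x) + d% (fun y ↦ g.inner y (X y) (Z y)) x (Y x)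
    - d% (fun y ↦ g.inner y (X y) (Y y)) x (Z x)
    + g.inner x (mlieBracket I X Y x) (Z x) - g.inner x (mlieBracket I X Z x) (Y x)
    - g.inner x (mlieBracket I Y Z x) (X x)

variable {X X' Y Y' Z Z' : ∀ x : M, TangentSpace I x} {x : M}

theorem koszul_tensorial_left (hY : MDiffAt (T% Y) x) (hZ : MDiffAt (T% Z) x) :
    TensorialAt I E (fun X ↦ g.koszul X Y Z x) x where
  smul {f X} hf hX := by
    simp only [koszul, g.d_inner_smul hf hX hZ, g.d_inner_smul hf hX hY,
      mlieBracket_smul_left hf hX]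
    simp [g.symm x (X x)]
    ring
  add {X X'} hX hX' := by
    simp only [koszul, g.d_inner_add hX hX' hZ, g.d_inner_add hX hX' hY,
      mlieBracket_add_left hX hX']
    simp
    ring

theorem koszul_tensorial_right (hX : MDiffAt (T% X) x) (hY : MDiffAt (T% Y) x) :
    TensorialAt I E (fun Z ↦ g.koszul X Y Z x) x where
  smul {f Z} hf hZ := by
    simp only [koszul, g.d_inner_comm _ (f • Z), g.d_inner_smul hf hZ hX, g.d_inner_smul hf hZ hY,
      mlieBracket_smul_right hf hZ, g.d_inner_comm _ Z]
    simp [g.symm x _ (Z x)]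
    ring
  add {Z Z'} hZ hZ' := by
    simp only [koszul, g.d_inner_comm _ (Z + Z'), g.d_inner_add hZ hZ' hX, g.d_inner_add hZ hZ' hY,
      mlieBracket_add_right hZ hZ', g.d_inner_comm _ Z, g.d_inner_comm _ Z']
    simp
    ring

theorem koszul_add (hX : MDiffAt (T% X) x) (hY : MDiffAt (T% Y) x) (hY' : MDiffAt (T% Y') x)
    (hZ : MDiffAt (T% Z) x) :
    g.koszul X (Y + Y') Z x = g.koszul X Y Z x + g.koszul X Y' Z x := by
  simp only [koszul, g.d_inner_comm X, g.d_inner_add hY hY' hX, g.d_inner_add hY hY' hZ,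
    mlieBracket_add_left hY hY', mlieBracket_add_right hY hY']
  simp
  ring

theorem koszul_smul {f : M → ℝ} (hf : MDiffAt f x) (hX : MDiffAt (T% X) x)
    (hY : MDiffAt (T% Y) x) (hZ : MDiffAt (T% Z) x) :
    g.koszul X (f • Y) Z x
      = f x * g.koszul X Y Z x + 2 * (d% f x (X x) * g.inner x (Y x) (Z x)) := by
  simp only [koszul, g.d_inner_comm X, g.d_inner_smul hf hY hX, g.d_inner_smul hf hY hZ,
    mlieBracket_smul_left hf hY, mlieBracket_smul_right hf hY]
  simp [g.symm x _ (X x)]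
  ring

/-- For a field `Y` differentiable at `x`, the bilinear form `(v, w) ↦ g(∇_v Y, w)` on `T_x M`
given by the Koszul formula; zero by convention if `Y` is not differentiable at `x`. -/
def koszulForm (Y : ∀ x : M, TangentSpace I x) (x : M) :
    TangentSpace I x →L[ℝ] TangentSpace I x →L[ℝ] ℝ :=
  open Classical in
  if hY : MDiffAt (T% Y) x then
    (2⁻¹ : ℝ) • TensorialAt.mkHom₂ (fun X Z ↦ g.koszul X Y Z x) x
      (fun _ hZ ↦ g.koszul_tensorial_left hY hZ) (fun _ hX ↦ g.koszul_tensorial_right hX hY)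
  else 0

theorem koszulForm_apply (hX : MDiffAt (T% X) x) (hY : MDiffAt (T% Y) x)
    (hZ : MDiffAt (T% Z) x) :
    g.koszulForm Y x (X x) (Z x) = 2⁻¹ * g.koszul X Y Z x := by
  have := TensorialAt.mkHom₂_apply (Φ := fun X Z ↦ g.koszul X Y Z x) (x := x)
    (fun _ hZ ↦ g.koszul_tensorial_left hY hZ) (fun _ hX ↦ g.koszul_tensorial_right hX hY) hX hZ
  simp only [koszulForm, dif_pos hY]
  rw [← this]
  rfl

theorem inner_injective (x : M) : Function.Injective (g.inner x) := by
  rw [injective_iff_map_eq_zero]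
  intro v hv
  by_contra h
  have := g.pos x v h
  simp [hv] at this

/-- The musical isomorphism `v ↦ g(v, ·)` from `T_x M` to its dual. -/
def flat (x : M) : TangentSpace I x ≃L[ℝ] (TangentSpace I x →L[ℝ] ℝ) :=
  haveI : FiniteDimensional ℝ (TangentSpace I x) := inferInstanceAs (FiniteDimensional ℝ E)
  haveI : T2Space (TangentSpace I x) := inferInstanceAs (T2Space E)
  (LinearEquiv.ofInjectiveOfFinrankEq (g.inner x).toLinearMap (g.inner_injective x)
    ((LinearMap.toContinuousLinearMap (𝕜 := ℝ) (E := E) (F' := ℝ)).finrank_eq.symm.trans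
      Subspace.dual_finrank_eq).symm).toContinuousLinearEquiv

theorem flat_apply (x : M) (v : TangentSpace I x) : g.flat x v = g.inner x v := rfl

theorem inner_flat_symm (x : M) (φ : TangentSpace I x →L[ℝ] ℝ) :
    g.inner x ((g.flat x).symm φ) = φ := by
  rw [← g.flat_apply, ContinuousLinearEquiv.apply_symm_apply]

theorem ext_inner {v w : TangentSpace I x} (h : ∀ Z : ∀ x : M, TangentSpace I x,
    MDiffAt (T% Z) x → g.inner x v (Z x) = g.inner x w (Z x)) : v = w := by
  apply g.inner_injective x
  ext u
  simpa using h (FiberBundle.extend E u) (FiberBundle.mdifferentiableAt_extend ..)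

/-- The operator `(Y, v) ↦ ∇_v Y` of the Levi-Civita connection: `g(∇_v Y, ·)` is given by the
Koszul formula. -/
def lcFun (Y : ∀ x : M, TangentSpace I x) (x : M) : TangentSpace I x →L[ℝ] TangentSpace I x :=
  (g.flat x).symm.toContinuousLinearMap.comp (g.koszulForm Y x)

theorem inner_lcFun (hX : MDiffAt (T% X) x) (hY : MDiffAt (T% Y) x) (hZ : MDiffAt (T% Z) x) :
    g.inner x (g.lcFun Y x (X x)) (Z x) = 2⁻¹ * g.koszul X Y Z x := by
  rw [← g.koszulForm_apply hX hY hZ]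
  simp [lcFun, inner_flat_symm]

/-- The Levi-Civita connection of `g`. That it is torsion-free and metric is proved in
`leviCivita_torsion` and `leviCivita_metric`. -/
def leviCivita : CovariantDerivative I E (TangentSpace I : M → Type _) where
  toFun := g.lcFun
  isCovariantDerivativeOnUniv :=
    { add := by
        intro Y Y' x hY hY' _
        ext u
        obtain ⟨X, hX, rfl⟩ : ∃ X : ∀ x : M, TangentSpace I x, MDiffAt (T% X) x ∧ X x = u :=
          ⟨FiberBundle.extend E u, FiberBundle.mdifferentiableAt_extend .., by simp⟩
        apply g.ext_inner
        intro Z hZ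
        simp only [_root_.add_apply, map_add]
        rw [g.inner_lcFun hX hY hZ, g.inner_lcFun hX hY' hZ,
          g.inner_lcFun hX (mdifferentiableAt_add_section hY hY') hZ, g.koszul_add hX hY hY' hZ]
        ring
      leibniz := by
        intro Y f x hY hf _
        ext u
        obtain ⟨X, hX, rfl⟩ : ∃ X : ∀ x : M, TangentSpace I x, MDiffAt (T% X) x ∧ X x = u :=
          ⟨FiberBundle.extend E u, FiberBundle.mdifferentiableAt_extend .., by simp⟩
        apply g.ext_inner
        intro Z hZ
        simp only [_root_.add_apply, map_add, _root_.smul_apply,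
          map_smul, ContinuousLinearMap.smulRight_apply, smul_eq_mul]
        rw [g.inner_lcFun hX hY hZ, g.inner_lcFun hX (hf.smul_section hY) hZ,
          g.koszul_smul hf hX hY hZ]
        ring }

theorem inner_leviCivita (hX : MDiffAt (T% X) x) (hY : MDiffAt (T% Y) x) (hZ : MDiffAt (T% Z) x) :
    g.inner x (g.leviCivita Y x (X x)) (Z x) = 2⁻¹ * g.koszul X Y Z x :=
  g.inner_lcFun hX hY hZ

/-- The Levi-Civita connection is torsion-free. -/
theorem leviCivita_torsion : g.leviCivita.torsion = 0 := by
  rw [CovariantDerivative.torsion_eq_zero_iff]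
  intro X Y x hX hY
  apply g.ext_inner
  intro Z hZ
  simp only [map_sub, _root_.sub_apply]
  rw [g.inner_leviCivita hX hY hZ, g.inner_leviCivita hY hX hZ]
  simp only [koszul, g.d_inner_comm Y X, mlieBracket_swap_apply (V := Y) (W := X)]
  simp
  ring

/-- The Levi-Civita connection is metric: `X g(Y, Z) = g(∇_X Y, Z) + g(Y, ∇_X Z)`. -/
theorem leviCivita_metric (hX : MDiffAt (T% X) x) (hY : MDiffAt (T% Y) x)
    (hZ : MDiffAt (T% Z) x) :
    d% (fun y ↦ g.inner y (Y y) (Z y)) x (X x)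
      = g.inner x (g.leviCivita Y x (X x)) (Z x) + g.inner x (Y x) (g.leviCivita Z x (X x)) := by
  rw [g.symm x (Y x), g.inner_leviCivita hX hY hZ, g.inner_leviCivita hX hZ hY]
  simp only [koszul, g.d_inner_comm Z Y, mlieBracket_swap_apply (V := Z) (W := Y)]
  simp
  ring

end Metric

/-! ### Contact metric structures -/

variable (I M) in
/-- A contact metric structure on `M`: a contact form `η` with its Reeb field `ξ`, an endomorphism
field `Φ` and a Riemannian metric `g` which are compatible. -/
structure ContactMetric where
  η : OneForm I M
  contact : η.IsContact
  ξ : ∀ x : M, TangentSpace I x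
  ξ_smooth : CMDiff ∞ (T% ξ)
  η_ξ : ∀ x, η.toFun x (ξ x) = 1
  dη_ξ : ∀ x v, η.d x (ξ x) v = 0
  Φ : ∀ x : M, TangentSpace I x →L[ℝ] TangentSpace I x
  Φ_smooth : ContMDiff I (I.prod 𝓘(ℝ, E →L[ℝ] E)) ∞ (fun x ↦ TotalSpace.mk' (E →L[ℝ] E) x (Φ x))
  Φ_ξ : ∀ x, Φ x (ξ x) = 0
  Φ_Φ : ∀ x v, Φ x (Φ x v) = -v + η.toFun x v • ξ x
  g : Metric I M
  g_eq : ∀ x v w, g.inner x v w = η.d x v (Φ x w) + η.toFun x v * η.toFun x w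
  g_Φ : ∀ x v w, g.inner x (Φ x v) (Φ x w) = g.inner x v w - η.toFun x v * η.toFun x w

namespace ContactMetric

variable (S : ContactMetric I M)

/-- The contact distribution `D = ker η`. -/
def D (x : M) : Submodule ℝ (TangentSpace I x) := LinearMap.ker (S.η.toFun x).toLinearMap

theorem mem_D {x : M} {v : TangentSpace I x} : v ∈ S.D x ↔ S.η.toFun x v = 0 := Iff.rfl

theorem ξ_ne_zero (x : M) : S.ξ x ≠ 0 := by
  intro h
  simpa [h] using S.η_ξ x

theorem η_Φ (x : M) (v : TangentSpace I x) : S.η.toFun x (S.Φ x v) = 0 := by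
  have h1 := S.Φ_Φ x (S.Φ x v)
  rw [S.Φ_Φ x v, map_add, map_neg, map_smul, S.Φ_ξ, smul_zero, add_zero] at h1
  have h2 : S.η.toFun x (S.Φ x v) • S.ξ x = 0 := by simpa using h1
  exact (smul_eq_zero.1 h2).resolve_right (S.ξ_ne_zero x)

/-- The almost CR structure `J` on `D`: the restriction of `Φ` to `D`. -/
def J (x : M) : S.D x →ₗ[ℝ] S.D x :=
  (S.Φ x).toLinearMap.restrict fun v _ ↦ S.η_Φ x v

theorem coe_J {x : M} (v : S.D x) : (S.J x v : TangentSpace I x) = S.Φ x v := rfl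

/-- The projection `v ↦ v^h = v - η(v) ξ` of `T_x M` onto `D` along `ξ`. -/
def hproj (x : M) : TangentSpace I x →ₗ[ℝ] S.D x :=
  LinearMap.codRestrict (S.D x)
    (LinearMap.id - (S.η.toFun x).toLinearMap.smulRight (S.ξ x))
    (fun v ↦ by simp [mem_D, S.η_ξ])

theorem coe_hproj {x : M} (v : TangentSpace I x) :
    (S.hproj x v : TangentSpace I x) = v - S.η.toFun x v • S.ξ x := rfl

/-- Sections of `D`, regarded as vector fields on `M`. -/
def toField (Y : ∀ x : M, S.D x) : ∀ x : M, TangentSpace I x := fun x ↦ Y x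

/-- Smooth sections of `D`. -/
def IsSmoothSection (Y : ∀ x : M, S.D x) : Prop := CMDiff ∞ (T% (S.toField Y))

/-- `J` applied to a section of `D`. -/
def applyJ (Y : ∀ x : M, S.D x) : ∀ x : M, S.D x := fun x ↦ S.J x (Y x)

/-- The induced connection on `D`: `∇^D_v Y = (∇_v Y)^h` for `v` in `D`, `∇^D_ξ Y = [ξ, Y]^h`,
extended linearly to all tangent vectors `v = v^h + η(v) ξ`. -/
def transverseConnection (Y : ∀ x : M, S.D x) (x : M) : TangentSpace I x →ₗ[ℝ] S.D x :=
  S.hproj x ∘ₗ (S.g.leviCivita (S.toField Y) x).toLinearMap ∘ₗ (S.D x).subtype ∘ₗ S.hproj x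
    + (S.η.toFun x).toLinearMap.smulRight (S.hproj x (mlieBracket I S.ξ (S.toField Y) x))

theorem transverseConnection_of_mem (Y : ∀ x : M, S.D x) {x : M} {v : TangentSpace I x}
    (hv : v ∈ S.D x) :
    S.transverseConnection Y x v = S.hproj x (S.g.leviCivita (S.toField Y) x v) := by
  have h : (S.hproj x v : TangentSpace I x) = v := by simp [coe_hproj, S.mem_D.1 hv]
  simp [transverseConnection, h, S.mem_D.1 hv]

theorem transverseConnection_ξ (Y : ∀ x : M, S.D x) (x : M) :
    S.transverseConnection Y x (S.ξ x) = S.hproj x (mlieBracket I S.ξ (S.toField Y) x) := by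
  have h : S.hproj x (S.ξ x) = 0 := by ext1; simp [coe_hproj, S.η_ξ]
  simp [transverseConnection, h, S.η_ξ]

/-- `∇^D J = 0`, that is, `(∇^D_v J) Y = ∇^D_v (J Y) - J (∇^D_v Y)` vanishes for every smooth
section `Y` of `D` and every tangent vector `v`. -/
def IsTransverselyParallel : Prop :=
  ∀ Y : ∀ x : M, S.D x, S.IsSmoothSection Y → ∀ (x : M) (v : TangentSpace I x),
    S.transverseConnection (S.applyJ Y) x v - S.J x (S.transverseConnection Y x v) = 0

/-- The almost CR structure `J` is integrable: for all smooth sections `X`, `Y` of `D` the field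
`[X, JY] + [JX, Y]` is a section of `D`, and `J ([X, JY] + [JX, Y]) = [JX, JY] - [X, Y]`. -/
def IsIntegrable : Prop :=
  ∀ X Y : ∀ x : M, S.D x, S.IsSmoothSection X → S.IsSmoothSection Y → ∀ x : M,
    ∃ h : mlieBracket I (S.toField X) (S.toField (S.applyJ Y)) x
        + mlieBracket I (S.toField (S.applyJ X)) (S.toField Y) x ∈ S.D x,
      (S.J x ⟨_, h⟩ : TangentSpace I x)
        = mlieBracket I (S.toField (S.applyJ X)) (S.toField (S.applyJ Y)) x
          - mlieBracket I (S.toField X) (S.toField Y) x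

/-- The Lie derivative `(L_ξ Φ) Y = [ξ, Φ Y] - Φ [ξ, Y]`. -/
def lieDerivΦ (Y : ∀ x : M, TangentSpace I x) (x : M) : TangentSpace I x :=
  mlieBracket I S.ξ (fun y ↦ S.Φ y (Y y)) x - S.Φ x (mlieBracket I S.ξ Y x)

/-- `L_ξ Φ = 0`. -/
def LieDerivΦEqZero : Prop :=
  ∀ Y : ∀ x : M, TangentSpace I x, CMDiff ∞ (T% Y) → ∀ x : M, S.lieDerivΦ Y x = 0

end ContactMetric

end ContactGeometry

end

noncomputable section

namespace ContactGeometry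

open Bundle VectorField

/-! The tensor `∇^D J` splits into its `ξ` part and its `D` part. Since `[ξ, Y]` is horizontal for
horizontal `Y`, the `ξ` part is `L_ξ Φ` on `D`; as `L_ξ Φ` also kills multiples of `ξ`, its
vanishing on `D` is equivalent to `L_ξ Φ = 0`.

The `D` part is the trilinear form `A(X, Y, Z) = g((∇_X Φ) Y, Z)` on horizontal fields (`covΦ`), and
the problem becomes one about almost Kähler structures. Skewness of `Φ` makes `A` skew in `Y, Z`;
`Φ² = -1` on `D` gives `A(X, ΦY, Z) = A(X, Y, ΦZ)`; and `d(dη) = 0`, with `dη = g(Φ·, ·)`, makes the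
cyclic sum of `A` vanish. Integrability adds one more linear identity, and together these force `A =
0` (`covΦ_eq_zero`).

Conversely, if `∇^D J = 0`, then `∇_X (ΦY) = Φ ∇_X Y` modulo `ξ`, and absence of torsion gives the
bracket identity modulo `ξ`. The `ξ` components agree because `η([X, Y]) = -g(ΦX, Y)` and `g` is
`Φ`-invariant on `D`. -/

theorem two_le_infty : (2 : WithTop ℕ∞) ≤ ∞ :=
  WithTop.coe_le_coe.2 (le_top : (2 : ℕ∞) ≤ ⊤)

theorem three_le_infty : (3 : WithTop ℕ∞) ≤ ∞ :=
  WithTop.coe_le_coe.2 (le_top : (3 : ℕ∞) ≤ ⊤)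

/-! ### Global fields, the exterior derivative and the Jacobi identity -/

section

variable {E : Type*} [NormedAddCommGroup E] [NormedSpace ℝ E] [FiniteDimensional ℝ E]
  {H : Type*} [TopologicalSpace H] {I : ModelWithCorners ℝ E H}
  {M : Type*} [TopologicalSpace M] [ChartedSpace H M] [IsManifold I ∞ M]

/-- On a Hausdorff manifold every tangent vector extends to a global smooth vector field. -/
theorem exists_smooth_field [T2Space M] {x : M} (v : TangentSpace I x) :
    ∃ V : ∀ x : M, TangentSpace I x, CMDiff ∞ (T% V) ∧ V x = v := by
  obtain ⟨s, hs, hsV⟩ := FiberBundle.exists_contMDiffOn_extend (k := ∞) I E v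
  obtain ⟨ρ, -, hρ⟩ := (SmoothBumpFunction.nhds_basis_tsupport (I := I) x).mem_iff.1
    (interior_mem_nhds.2 hs)
  refine ⟨fun y ↦ ρ y • FiberBundle.extend E v y, ?_, by simp⟩
  exact ContMDiffOn.smul_section_of_tsupport (ρ.contMDiff.contMDiffOn) isOpen_interior hρ
    (hsV.mono interior_subset)

theorem OneForm.d_antisymm (α : OneForm I M) (x : M) (v w : TangentSpace I x) :
    α.d x v w = - α.d x w v := by
  have hX := FiberBundle.mdifferentiableAt_extend I E v
  have hY := FiberBundle.mdifferentiableAt_extend I E w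
  have h1 := TensorialAt.mkHom₂_apply (Φ := fun X Y ↦ α.dAux X Y x) (x := x)
    (fun Y hY ↦ α.dAux_tensorial_left Y hY) (fun X hX ↦ α.dAux_tensorial_right X hX) hX hY
  have h2 := TensorialAt.mkHom₂_apply (Φ := fun X Y ↦ α.dAux X Y x) (x := x)
    (fun Y hY ↦ α.dAux_tensorial_left Y hY) (fun X hX ↦ α.dAux_tensorial_right X hX) hY hX
  simp only [FiberBundle.extend_apply_self] at h1 h2
  change α.d x v w = _ at h1
  change α.d x w v = _ at h2
  rw [h1, h2, α.dAux_swap]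

set_option linter.unusedSectionVars false in
theorem OneForm.contMDiff_apply (α : OneForm I M) {X : ∀ x : M, TangentSpace I x}
    (hX : CMDiff ∞ (T% X)) : CMDiff ∞ (fun y ↦ α.toFun y (X y)) := by
  intro x
  have h2 : ContMDiffAt I (I.prod 𝓘(ℝ)) ∞
      (fun m ↦ TotalSpace.mk' ℝ (E := Bundle.Trivial M ℝ) m (α.toFun m (X m))) x :=
    ContMDiffAt.clm_bundle_apply (F₁ := E) (F₂ := ℝ) (α.smooth x) (hX x)
  simp only [contMDiffAt_totalSpace] at h2
  exact h2.2

set_option linter.unusedSectionVars false in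
theorem mvfderiv_neg_one_smul {f : M → ℝ} {x : M} (hf : MDiffAt f x) :
    d% ((-1 : ℝ) • f) x = - d% f x := by
  have h := mvfderiv_smul (a := fun _ : M ↦ (-1 : ℝ)) (mdifferentiableAt_const ..) hf
  have e : (-1 : ℝ) • f = (fun _ : M ↦ (-1 : ℝ)) • f := rfl
  rw [e, h]
  simp [mvfderiv_const]

theorem mdiffAt_mlieBracket {X Y : ∀ x : M, TangentSpace I x} (hX : CMDiff ∞ (T% X))
    (hY : CMDiff ∞ (T% Y)) (x : M) : MDiffAt (T% (mlieBracket I X Y)) x := by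
  have : IsManifold I (((2 : ℕ∞) : WithTop ℕ∞) + 1) M :=
    .of_le (n := ∞) (by exact_mod_cast le_top)
  have : CompleteSpace E := FiniteDimensional.complete ℝ E
  have : IsManifold I (minSmoothness ℝ 2) M :=
    .of_le (n := ∞) (by simpa using two_le_infty)
  have h2 : ((2 : ℕ∞) : WithTop ℕ∞) ≤ ∞ := two_le_infty
  exact (ContMDiffAt.mlieBracket_vectorField (m := 1) (n := 2) ((hX x).of_le h2) ((hY x).of_le h2)
    (by simp; norm_num)).mdifferentiableAt (by simp)

theorem jacobi_mlieBracket {X Y Z : ∀ x : M, TangentSpace I x} (hX : CMDiff ∞ (T% X))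
    (hY : CMDiff ∞ (T% Y)) (hZ : CMDiff ∞ (T% Z)) (x : M) :
    mlieBracket I (mlieBracket I X Y) Z x + mlieBracket I (mlieBracket I Y Z) X x
      + mlieBracket I (mlieBracket I Z X) Y x = 0 := by
  have : IsManifold I (minSmoothness ℝ 3) M :=
    .of_le (n := ∞) (by simpa using three_le_infty)
  have : CompleteSpace E := FiniteDimensional.complete ℝ E
  have h2 : minSmoothness ℝ 2 ≤ ∞ := by simpa using two_le_infty
  have h := leibniz_identity_mlieBracket_apply ((hX x).of_le h2) ((hY x).of_le h2)
    ((hZ x).of_le h2)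
  have e1 : mlieBracket I (mlieBracket I Y Z) X x = - mlieBracket I X (mlieBracket I Y Z) x :=
    mlieBracket_swap_apply
  have e2 : mlieBracket I (mlieBracket I Z X) Y x = mlieBracket I Y (mlieBracket I X Z) x := by
    rw [mlieBracket_swap (V := Z), mlieBracket_swap_apply]
    rw [show (-mlieBracket I X Z) = (-1 : ℝ) • mlieBracket I X Z by simp,
      mlieBracket_const_smul_right (mdiffAt_mlieBracket hX hZ x)]
    simp
  rw [e1, e2, h]
  abel

/-! ### Algebra of `Φ`, `g`, `dη` and horizontal fields -/

namespace ContactMetric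

variable (S : ContactMetric I M)

theorem inner_Φ_ξ (x : M) (v : TangentSpace I x) : S.g.inner x (S.Φ x v) (S.ξ x) = 0 := by
  rw [S.g_eq, S.Φ_ξ, S.η_Φ]; simp

/-- Put `Φ w` for `w` in the invariance `g_Φ`; the `ξ` term of `Φ²` drops out because `Φ v` is
orthogonal to `ξ`. -/
theorem inner_Φ_left (x : M) (v w : TangentSpace I x) :
    S.g.inner x (S.Φ x v) w = - S.g.inner x v (S.Φ x w) := by
  have h := S.g_Φ x v (S.Φ x w)
  rw [S.Φ_Φ, S.η_Φ, map_add, map_neg, map_smul, S.inner_Φ_ξ] at h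
  simp at h
  linarith

theorem dη_eq_inner (x : M) (v w : TangentSpace I x) :
    S.η.d x v w = S.g.inner x (S.Φ x v) w := by
  have h := S.g_eq x v (S.Φ x w)
  rw [S.Φ_Φ, S.η_Φ, map_add, map_neg, map_smul, S.η.d_antisymm x v (S.ξ x), S.dη_ξ] at h
  rw [inner_Φ_left, h]
  simp

/-- `Φ` applied to a vector field. -/
def ΦField (X : ∀ x : M, TangentSpace I x) : ∀ x : M, TangentSpace I x := fun x ↦ S.Φ x (X x)

/-- Smooth sections of the contact distribution, as vector fields on `M`. -/
structure IsHorizontal (X : ∀ x : M, TangentSpace I x) : Prop where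
  smooth : CMDiff ∞ (T% X)
  η_eq_zero : ∀ x, S.η.toFun x (X x) = 0

variable {S}

theorem contMDiff_ΦField {X : ∀ x : M, TangentSpace I x} (hX : CMDiff ∞ (T% X)) :
    CMDiff ∞ (T% (S.ΦField X)) :=
  fun x ↦ ContMDiffAt.clm_bundle_apply (F₁ := E) (F₂ := E) (S.Φ_smooth x) (hX x)

namespace IsHorizontal

variable {X Y Z : ∀ x : M, TangentSpace I x}

theorem mdiffAt (hX : S.IsHorizontal X) (x : M) : MDiffAt (T% X) x :=
  (hX.smooth x).mdifferentiableAt (by simp)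

theorem ΦField (hX : S.IsHorizontal X) : S.IsHorizontal (S.ΦField X) :=
  ⟨contMDiff_ΦField hX.smooth, fun x ↦ S.η_Φ x (X x)⟩

theorem Φ_ΦField (hX : S.IsHorizontal X) (x : M) : S.Φ x (S.ΦField X x) = - X x := by
  simp [ContactMetric.ΦField, S.Φ_Φ, hX.η_eq_zero]

theorem ΦField_ΦField (hX : S.IsHorizontal X) : S.ΦField (S.ΦField X) = - X :=
  funext hX.Φ_ΦField

/-- Both derivative terms of `dη(X, Y)` vanish on horizontal fields, which leaves only the bracket
term. -/
theorem η_mlieBracket (hX : S.IsHorizontal X) (hY : S.IsHorizontal Y) (x : M) :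
    S.η.toFun x (mlieBracket I X Y x) = - S.g.inner x (S.Φ x (X x)) (Y x) := by
  rw [← dη_eq_inner, S.η.d_apply (hX.mdiffAt x) (hY.mdiffAt x)]
  simp [hX.η_eq_zero, hY.η_eq_zero, mvfderiv_const]

theorem mlieBracket_eq (hX : S.IsHorizontal X) (hY : S.IsHorizontal Y) (x : M) :
    mlieBracket I X Y x = S.g.leviCivita Y x (X x) - S.g.leviCivita X x (Y x) :=
  ((CovariantDerivative.torsion_eq_zero_iff _).1 S.g.leviCivita_torsion
    (hX.mdiffAt x) (hY.mdiffAt x)).symm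

end IsHorizontal

theorem IsSmoothSection.isHorizontal {Y : ∀ x : M, S.D x} (hY : S.IsSmoothSection Y) :
    S.IsHorizontal (S.toField Y) :=
  ⟨hY, fun x ↦ (Y x).2⟩

/-- A horizontal field as a section of `D`. -/
def IsHorizontal.toSection {X : ∀ x : M, TangentSpace I x} (hX : S.IsHorizontal X) :
    ∀ x : M, S.D x := fun x ↦ ⟨X x, hX.η_eq_zero x⟩

theorem isHorizontal_sub {X : ∀ x : M, TangentSpace I x} (hX : CMDiff ∞ (T% X)) :
    S.IsHorizontal (fun x ↦ X x - S.η.toFun x (X x) • S.ξ x) where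
  smooth := hX.sub_section ((S.η.contMDiff_apply hX).smul_section S.ξ_smooth)
  η_eq_zero x := by simp [S.η_ξ]

theorem exists_isHorizontal [T2Space M] {x : M} {v : TangentSpace I x}
    (hv : S.η.toFun x v = 0) : ∃ X, S.IsHorizontal X ∧ X x = v := by
  obtain ⟨V, hV, rfl⟩ := exists_smooth_field v
  exact ⟨_, isHorizontal_sub hV, by simp [hv]⟩

theorem applyJ_toField (Y : ∀ x : M, S.D x) : S.toField (S.applyJ Y) = S.ΦField (S.toField Y) :=
  rfl

/-! ### The tensor `∇Φ` on horizontal fields -/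

variable (S) in
/-- The trilinear form `g((∇_X Φ) Y, Z)`. -/
def covΦ (X Y Z : ∀ x : M, TangentSpace I x) (x : M) : ℝ :=
  S.g.inner x (S.g.leviCivita (S.ΦField Y) x (X x)) (Z x)
    + S.g.inner x (S.g.leviCivita Y x (X x)) (S.Φ x (Z x))

theorem leviCivita_neg {Y : ∀ x : M, TangentSpace I x} {x : M} (hY : MDiffAt (T% Y) x) :
    S.g.leviCivita (-Y) x = - S.g.leviCivita Y x := by
  have h := S.g.leviCivita.isCovariantDerivativeOnUniv.smul_const (x := x) (-1 : ℝ) hY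
  simpa using h

namespace IsHorizontal

variable {X Y Z : ∀ x : M, TangentSpace I x}

theorem neg (hX : S.IsHorizontal X) : S.IsHorizontal (-X) := by
  simpa [hX.ΦField_ΦField] using hX.ΦField.ΦField

/-- Differentiate `g(ΦY, Z) = -g(Y, ΦZ)` along `X`, using that the connection is metric. -/
theorem covΦ_swap (hX : S.IsHorizontal X) (hY : S.IsHorizontal Y) (hZ : S.IsHorizontal Z)
    (x : M) : S.covΦ X Y Z x = - S.covΦ X Z Y x := by
  have h1 := S.g.leviCivita_metric (hX.mdiffAt x) (hY.ΦField.mdiffAt x) (hZ.mdiffAt x)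
  have h2 := S.g.leviCivita_metric (hX.mdiffAt x) (hY.mdiffAt x) (hZ.ΦField.mdiffAt x)
  have h3 : (fun y ↦ S.g.inner y (S.ΦField Y y) (Z y))
      = (-1 : ℝ) • fun y ↦ S.g.inner y (Y y) (S.ΦField Z y) := by
    ext y
    simp [ContactMetric.ΦField, S.inner_Φ_left]
  have h4 : d% (fun y ↦ S.g.inner y (S.ΦField Y y) (Z y)) x (X x)
      = - d% (fun y ↦ S.g.inner y (Y y) (S.ΦField Z y)) x (X x) := by
    rw [h3, mvfderiv_neg_one_smul (S.g.mdiffAt_inner (hY.mdiffAt x) (hZ.ΦField.mdiffAt x))]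
    simp
  rw [h1, h2] at h4
  simp only [covΦ]
  rw [S.g.symm x _ (Y x), S.g.symm x _ (S.Φ x (Y x))]
  simp only [ContactMetric.ΦField] at h4 ⊢
  linarith

/-- By `Φ² = -1` on `D`, both sides equal `g(∇_X ΦY, ΦZ) - g(∇_X Y, Z)`. With skewness of `Φ`, this
says that `∇_X Φ` anticommutes with `Φ` on `D`. -/
theorem covΦ_ΦField_middle (hY : S.IsHorizontal Y)
    (hZ : S.IsHorizontal Z) (X : ∀ x : M, TangentSpace I x) (x : M) :
    S.covΦ X (S.ΦField Y) Z x = S.covΦ X Y (S.ΦField Z) x := by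
  simp only [covΦ, hY.ΦField_ΦField, hZ.Φ_ΦField, leviCivita_neg (hY.mdiffAt x), map_neg]
  simp [ContactMetric.ΦField]
  ring

theorem dη_mlieBracket (hX : S.IsHorizontal X) (hY : S.IsHorizontal Y) (hZ : S.IsHorizontal Z)
    (x : M) : S.η.d x (mlieBracket I X Y x) (Z x)
      = d% (fun y ↦ S.g.inner y (S.ΦField X y) (Y y)) x (Z x)
        - S.η.toFun x (mlieBracket I (mlieBracket I X Y) Z x) := by
  rw [S.η.d_apply (mdiffAt_mlieBracket hX.smooth hY.smooth x) (hZ.mdiffAt x)]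
  have h : (fun y ↦ S.η.toFun y (mlieBracket I X Y y))
      = (-1 : ℝ) • fun y ↦ S.g.inner y (S.ΦField X y) (Y y) := by
    ext y
    simp [hX.η_mlieBracket hY, ContactMetric.ΦField]
  rw [h, mvfderiv_neg_one_smul (S.g.mdiffAt_inner (hX.ΦField.mdiffAt x) (hY.mdiffAt x))]
  simp [hZ.η_eq_zero, mvfderiv_const]

/-- The form `g(Φ ·, ·) = dη` is closed on horizontal fields. -/
theorem covΦ_cyclic (hX : S.IsHorizontal X) (hY : S.IsHorizontal Y) (hZ : S.IsHorizontal Z)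
    (x : M) : S.covΦ X Y Z x + S.covΦ Y Z X x + S.covΦ Z X Y x = 0 := by
  have j := congrArg (S.η.toFun x) (jacobi_mlieBracket hX.smooth hY.smooth hZ.smooth x)
  simp only [map_add, map_zero] at j
  -- `η([[X, Y], Z]) = Z g(ΦX, Y) - g(Φ[X, Y], Z)`, expanded by metricity and absence of torsion.
  -- Its cyclic sum vanishes by Jacobi, which is where `d(dη) = 0` enters.
  have key : ∀ {X Y Z : ∀ x : M, TangentSpace I x}, S.IsHorizontal X → S.IsHorizontal Y →
      S.IsHorizontal Z → S.η.toFun x (mlieBracket I (mlieBracket I X Y) Z x)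
        = S.g.inner x (S.g.leviCivita (S.ΦField X) x (Z x)) (Y x)
          + S.g.inner x (S.Φ x (X x)) (S.g.leviCivita Y x (Z x))
          - S.g.inner x (S.Φ x (S.g.leviCivita Y x (X x))) (Z x)
          + S.g.inner x (S.Φ x (S.g.leviCivita X x (Y x))) (Z x) := by
    intro X Y Z hX hY hZ
    have h := hX.dη_mlieBracket hY hZ x
    rw [S.g.leviCivita_metric (hZ.mdiffAt x) (hX.ΦField.mdiffAt x) (hY.mdiffAt x),
      dη_eq_inner, hX.mlieBracket_eq hY] at h
    simp only [map_sub, _root_.sub_apply, ContactMetric.ΦField] at h ⊢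
    linarith
  rw [key hX hY hZ, key hY hZ hX, key hZ hX hY] at j
  simp only [covΦ]
  simp only [S.inner_Φ_left x (S.g.leviCivita _ x _), S.g.symm x (S.Φ x _)] at j
  linarith

theorem toField_toSection (hX : S.IsHorizontal X) : S.toField hX.toSection = X := rfl

/-- The integrability condition in terms of `∇Φ`. -/
theorem covΦ_of_isIntegrable (hS : S.IsIntegrable) (hX : S.IsHorizontal X)
    (hY : S.IsHorizontal Y) (Z : ∀ x : M, TangentSpace I x) (x : M) :
    S.covΦ (S.ΦField X) Y Z x - S.covΦ (S.ΦField Y) X Z x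
      + S.covΦ X (S.ΦField Y) Z x - S.covΦ Y (S.ΦField X) Z x = 0 := by
  obtain ⟨_, h⟩ := hS hX.toSection hY.toSection hX.smooth hY.smooth x
  rw [coe_J] at h
  simp only [applyJ_toField, hX.toField_toSection, hY.toField_toSection] at h
  rw [hX.mlieBracket_eq hY.ΦField, hX.ΦField.mlieBracket_eq hY,
    hX.ΦField.mlieBracket_eq hY.ΦField, hX.mlieBracket_eq hY] at h
  replace h := congrArg (fun v ↦ S.g.inner x v (Z x)) h
  simp only [map_add, map_sub, _root_.add_apply, _root_.sub_apply, S.inner_Φ_left] at h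
  simp only [covΦ, hX.ΦField_ΦField, hY.ΦField_ΦField, leviCivita_neg (hX.mdiffAt x),
    leviCivita_neg (hY.mdiffAt x)]
  simp
  linarith

/-- In the integrability identity for `X, Y` tested on `Z`, skewness and the cyclic identities for
`(ΦX, Y, Z)` and `(X, ΦY, Z)` turn the four terms into `-A(Z, ΦX, Y) - A(Z, X, ΦY)`. Moving `Φ`
across makes this `-2 A(Z, ΦX, Y)`. -/
theorem covΦ_eq_zero (hS : S.IsIntegrable) (hX : S.IsHorizontal X)
    (hY : S.IsHorizontal Y) (hZ : S.IsHorizontal Z) (x : M) : S.covΦ X Y Z x = 0 := by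
  have key : ∀ {X Y Z : ∀ x : M, TangentSpace I x}, S.IsHorizontal X → S.IsHorizontal Y →
      S.IsHorizontal Z → S.covΦ X (S.ΦField Y) Z x = 0 := by
    intro Z X Y hZ hX hY
    have h0 := covΦ_of_isIntegrable hS hX hY Z x
    have h1 := hX.ΦField.covΦ_cyclic hY hZ x
    have h2 := hX.covΦ_cyclic hY.ΦField hZ x
    have h3 := hY.ΦField.covΦ_swap hX hZ x
    have h4 := hY.covΦ_swap hX.ΦField hZ x
    have h5 := hX.covΦ_ΦField_middle hY Z x
    linarith
  -- `Φ⁴ = 1` on horizontal fields, so `Y` is `Φ` of the horizontal field `Φ³ Y`.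
  have h := key hX hY.ΦField.ΦField.ΦField hZ
  simpa [hY.ΦField_ΦField, hY.ΦField.ΦField.ΦField_ΦField, hY.ΦField.ΦField_ΦField,
    hY.neg.ΦField_ΦField] using h

end IsHorizontal

/-! ### Parallelism of `J` against integrability and `L_ξ Φ = 0` -/

section Parallel

/-- The value of `∇^D J` on a tangent vector, as a tangent vector. -/
theorem coe_transverseConnection_sub (Y : ∀ x : M, S.D x) (x : M) (v : TangentSpace I x) :
    ((S.transverseConnection (S.applyJ Y) x v - S.J x (S.transverseConnection Y x v) : S.D x) :
        TangentSpace I x)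
      = S.hproj x (S.g.leviCivita (S.ΦField (S.toField Y)) x (S.hproj x v))
        - S.Φ x (S.g.leviCivita (S.toField Y) x (S.hproj x v))
        + S.η.toFun x v • (S.hproj x (mlieBracket I S.ξ (S.ΦField (S.toField Y)) x)
          - S.Φ x (mlieBracket I S.ξ (S.toField Y) x)) := by
  rw [AddSubgroupClass.coe_sub, coe_J]
  simp only [transverseConnection, applyJ_toField, LinearMap.add_apply, LinearMap.comp_apply,
    LinearMap.smulRight_apply, Submodule.coe_add, Submodule.coe_smul, Submodule.subtype_apply,
    ContinuousLinearMap.coe_coe, map_add, map_smul]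
  have h : ∀ u : TangentSpace I x, S.Φ x (S.hproj x u) = S.Φ x u := fun u ↦ by
    simp [coe_hproj, S.Φ_ξ]
  rw [h, h, smul_sub]
  abel

theorem η_mlieBracket_ξ {Y : ∀ x : M, TangentSpace I x} (hY : S.IsHorizontal Y) (x : M) :
    S.η.toFun x (mlieBracket I S.ξ Y x) = 0 := by
  have h := S.η.d_apply ((S.ξ_smooth x).mdifferentiableAt (by simp)) (hY.mdiffAt x)
  rw [S.dη_ξ] at h
  simpa [hY.η_eq_zero, S.η_ξ, mvfderiv_const] using h.symm

/-- A multiple `f ξ` contributes nothing: `Φ(f ξ) = 0`, and `[ξ, f ξ] = ξ(f) ξ` is killed by `Φ`.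
Hence `L_ξ Φ` need only be tested on horizontal fields. -/
theorem lieDerivΦ_eq (Y : ∀ x : M, TangentSpace I x) (hY : CMDiff ∞ (T% Y)) (x : M) :
    S.lieDerivΦ Y x = S.lieDerivΦ (fun x ↦ Y x - S.η.toFun x (Y x) • S.ξ x) x := by
  have hf := ((S.η.contMDiff_apply hY) x).mdifferentiableAt (by simp)
  have hξ : MDiffAt (T% S.ξ) x := (S.ξ_smooth x).mdifferentiableAt (by simp)
  have hH := (isHorizontal_sub (S := S) hY).mdiffAt x
  have e : Y = (fun x ↦ Y x - S.η.toFun x (Y x) • S.ξ x)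
      + (fun x ↦ S.η.toFun x (Y x)) • S.ξ := by
    ext y; simp
  have h1 : mlieBracket I S.ξ Y x
      = mlieBracket I S.ξ (fun x ↦ Y x - S.η.toFun x (Y x) • S.ξ x) x
        + d% (fun x ↦ S.η.toFun x (Y x)) x (S.ξ x) • S.ξ x := by
    conv_lhs => rw [e]
    rw [mlieBracket_add_right hH (hf.smul_section hξ), mlieBracket_smul_right hf hξ]
    simp
  simp only [lieDerivΦ, h1, map_add, map_sub, map_smul, S.Φ_ξ, smul_zero, add_zero, sub_zero]

theorem isTransverselyParallel_of_isIntegrable [T2Space M] (hS : S.IsIntegrable)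
    (hL : S.LieDerivΦEqZero) : S.IsTransverselyParallel := by
  intro Y hY x v
  ext1
  rw [coe_transverseConnection_sub]
  have hY' := hY.isHorizontal
  have h1 : mlieBracket I S.ξ (S.ΦField (S.toField Y)) x
      = S.Φ x (mlieBracket I S.ξ (S.toField Y) x) := sub_eq_zero.1 (hL _ hY x)
  rw [h1, coe_hproj, coe_hproj S (S.Φ x _), S.η_Φ]
  obtain ⟨X, hX, hXv⟩ := exists_isHorizontal (S.hproj x v).2
  set u := S.g.leviCivita (S.ΦField (S.toField Y)) x (S.hproj x v) with hu
  set u' := S.g.leviCivita (S.toField Y) x (S.hproj x v) with hu'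
  -- This vector `w` is the `D` part of `∇^D J`. It is horizontal, so it extends to a horizontal
  -- `Z`; since `ξ` is orthogonal to `w`, `g(w, w)` is `A(X, Y, Z) = 0` at `x`.
  have h2 : u - S.η.toFun x u • S.ξ x - S.Φ x u' = 0 := by
    set w := u - S.η.toFun x u • S.ξ x - S.Φ x u' with hw
    have hηw : S.η.toFun x w = 0 := by simp [hw, S.η_ξ, S.η_Φ]
    by_contra hne
    obtain ⟨Z, hZ, hZw⟩ := exists_isHorizontal hηw
    have h3 := hX.covΦ_eq_zero hS hY' hZ x
    rw [covΦ, hXv, ← hu, ← hu', hZw] at h3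
    have h4 : S.g.inner x (S.ξ x) w = 0 := by
      rw [S.g_eq, S.dη_ξ, hηw]; simp
    have h5 : S.g.inner x w w = 0 := by
      conv_lhs => enter [1]; rw [hw]
      simp only [map_sub, map_smul, _root_.sub_apply, _root_.smul_apply, h4, S.inner_Φ_left]
      simp
      linarith
    exact (S.g.pos x w hne).ne' h5
  rw [h2]
  simp

theorem lieDerivΦEqZero_of_isTransverselyParallel (hS : S.IsTransverselyParallel) :
    S.LieDerivΦEqZero := by
  intro Y hY x
  rw [lieDerivΦ_eq Y hY]
  have hH := isHorizontal_sub (S := S) hY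
  have h := congrArg (Subtype.val) (hS hH.toSection hH.smooth x (S.ξ x))
  have h0 : (S.hproj x (S.ξ x) : TangentSpace I x) = 0 := by simp [coe_hproj, S.η_ξ]
  rw [coe_transverseConnection_sub, h0, hH.toField_toSection, coe_hproj, coe_hproj,
    η_mlieBracket_ξ hH.ΦField] at h
  change mlieBracket I S.ξ (S.ΦField _) x - _ = 0
  simpa [S.η_ξ] using h

/-- The horizontal projection in `∇^D` hides the `ξ` component of `∇_X (ΦY)`, so `∇_X` commutes with
`Φ` only up to a multiple of `ξ`. -/
theorem leviCivita_ΦField (hS : S.IsTransverselyParallel) {X Y : ∀ x : M, TangentSpace I x}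
    (hX : S.IsHorizontal X) (hY : S.IsHorizontal Y) (x : M) :
    ∃ a : ℝ, S.g.leviCivita (S.ΦField Y) x (X x)
      = S.Φ x (S.g.leviCivita Y x (X x)) + a • S.ξ x := by
  have h := congrArg (Subtype.val) (hS hY.toSection hY.smooth x (X x))
  have h0 : (S.hproj x (X x) : TangentSpace I x) = X x := by simp [coe_hproj, hX.η_eq_zero]
  rw [coe_transverseConnection_sub, h0, hY.toField_toSection, coe_hproj, hX.η_eq_zero, zero_smul,
    add_zero, ZeroMemClass.coe_zero, sub_sub, sub_eq_zero, add_comm] at h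
  exact ⟨_, h⟩

theorem isIntegrable_of_isTransverselyParallel (hS : S.IsTransverselyParallel) :
    S.IsIntegrable := by
  intro X' Y' hX' hY' x
  rw [applyJ_toField, applyJ_toField]
  replace hX' := hX'.isHorizontal
  replace hY' := hY'.isHorizontal
  set X := S.toField X'
  set Y := S.toField Y'
  -- The left side is `-g(ΦX, ΦY) + g(X, Y)`, zero by `Φ`-invariance of `g` on `D`.
  have h1 : S.η.toFun x (mlieBracket I X (S.ΦField Y) x + mlieBracket I (S.ΦField X) Y x) = 0 := by
    rw [map_add, hX'.η_mlieBracket hY'.ΦField, hX'.ΦField.η_mlieBracket hY', hX'.Φ_ΦField]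
    have := S.g_Φ x (X x) (Y x)
    rw [hX'.η_eq_zero] at this
    simp [ContactMetric.ΦField, this]
  refine ⟨h1, ?_⟩
  rw [coe_J]
  have h2 : S.η.toFun x (mlieBracket I (S.ΦField X) (S.ΦField Y) x - mlieBracket I X Y x) = 0 := by
    rw [map_sub, hX'.ΦField.η_mlieBracket hY'.ΦField, hX'.η_mlieBracket hY']
    have := S.g_Φ x (S.ΦField X x) (Y x)
    rw [hY'.η_eq_zero] at this
    simp only [ContactMetric.ΦField] at this ⊢
    linarith
  obtain ⟨a, ha⟩ := leviCivita_ΦField hS hX' hY' x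
  obtain ⟨b, hb⟩ := leviCivita_ΦField hS hY' hX' x
  obtain ⟨c, hc⟩ := leviCivita_ΦField hS hX'.ΦField hY' x
  obtain ⟨d, hd⟩ := leviCivita_ΦField hS hY'.ΦField hX' x
  have h3 : ∃ e : ℝ, mlieBracket I (S.ΦField X) (S.ΦField Y) x - mlieBracket I X Y x
      = S.Φ x (mlieBracket I X (S.ΦField Y) x + mlieBracket I (S.ΦField X) Y x) + e • S.ξ x := by
    -- The `η` terms come from `Φ² v = -v + η(v) ξ` at `v = ∇_X Y` and `v = ∇_Y X`. The exact value
    -- is immaterial: both bracket expressions are horizontal, so it must vanish.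
    refine ⟨c - d - S.η.toFun x (S.g.leviCivita Y x (X x))
      + S.η.toFun x (S.g.leviCivita X x (Y x)), ?_⟩
    rw [hX'.mlieBracket_eq hY'.ΦField, hX'.ΦField.mlieBracket_eq hY',
      hX'.ΦField.mlieBracket_eq hY'.ΦField, hX'.mlieBracket_eq hY', ha, hb, hc, hd]
    simp only [map_add, map_sub, map_smul, S.Φ_Φ, S.Φ_ξ, smul_zero]
    module
  obtain ⟨e, he⟩ := h3
  have he0 : e = 0 := by
    rw [he] at h2
    simpa [S.η_Φ, S.η_ξ] using h2
  rw [he, he0]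
  simp

end Parallel

end ContactMetric
end
end ContactGeometry
end

theorem proposition3p2 {E : Type*} [NormedAddCommGroup E] [NormedSpace ℝ E]
    [FiniteDimensional ℝ E] {H : Type*} [TopologicalSpace H] {I : ModelWithCorners ℝ E H}
    {M : Type*} [TopologicalSpace M] [T2Space M] [ChartedSpace H M] [IsManifold I ∞ M]
    [BoundarylessManifold I M] (S : ContactGeometry.ContactMetric I M) :
    S.IsTransverselyParallel ↔ S.IsIntegrable ∧ S.LieDerivΦEqZero :=
  ⟨fun h ↦ ⟨ContactGeometry.ContactMetric.isIntegrable_of_isTransverselyParallel h,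
    ContactGeometry.ContactMetric.lieDerivΦEqZero_of_isTransverselyParallel h⟩,
   fun h ↦ ContactGeometry.ContactMetric.isTransverselyParallel_of_isIntegrable h.1 h.2⟩
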